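/- **Co-skew symmetry of the splitting operations.** Let $F$ be a smooth oriented surface, with or without boundary, compact or not. *Diagrams.* A geometrical chord diagram with external chords consists of $n$ oriented core circles, labelled $1,\dots,n$, mapped to $F$, and finitely many unoriented chords with pairwise disjoint endpoint sets, each joining two points on distinct core circles that have the same image in $F$ (a chord is mapped to that point). A chord diagram is a homotopy class of these: core circles may be reparametrized by orientation-preserving homeomorphisms, and homotopies of the maps must at each time map each chord to a point. Let $M_e$ be the free $\mathbb Z$-module on all chord diagrams with labelled core circles and external chords only, and $N_e\subset M_e$ the submodule generated by the differences $[D]-[D']$ where $D'$ arises from $D$ by one of the following moves. Call two points of a core circle adjacent if they bound an arc of it that is mapped to one point and has no chord endpoint in its interior. (a) Two chords with adjacent endpoints $u,v$ on a core circle exchange these endpoints (one chord slides past the other). (b) A chord with endpoint $u$ adjacent to the endpoint $v$ of a chord $\{v,z\}$ has its endpoint $u$ moved to a point $z'$ adjacent to $z$ (it slides across that chord to another core circle), provided its chord stays external. Put $ch_e=M_e/N_e$. *The map $\tau_i$.* For $i\ge 1$, $\tau_i: ch_e\to ch_e$ is the linear map that swaps the labels $i$ and $i+1$ of the core circles (and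 fixes diagrams which do not have both labels). *The map $\mu_i$.* Let $D$ be a diagram in general position: its core circles are smooth immersed curves with transverse intersections and self-intersections, each has finitely many self-intersection points, and none of these is at a chord endpoint. Let $a$ be the core circle with label $i$. A self-intersection point $p$ of $a$ is an unordered pair $t_1\ne t_2$ with $a(t_1)=a(t_2)$. It gives two loops $a([t_1,t_2])$ and $a([t_2,t_1])$; order the pair so that $(a'(t_1),a'(t_2))$ gives the orientation of $F$, and put $a^1_p=a([t_1,t_2])$, $a^2_p=a([t_2,t_1])$. Let $\mathcal{SI}^i_0$ be the set of those $p$ for which neither $a^1_p$ nor $a^2_p$ is null-homotopic. Let $D_p$ be $D$ with a chord added between $t_1$ and $t_2$. The diagram $S_p^+(D_p)$ (respectively $S_p^-(D_p)$) is obtained by splitting the $i$-th core circle into two core circles joined by the new chord at $p$, the one labelled $i$ mapped by $a^1_p$ (respectively $a^2_p$) and the one labelled $i+1$ mapped by $a^2_p$ (respectively $a^1_p$); all labels formerly greater than $i$ increase by one, and the old chords keep their endpoints. Put $$\mu_i(D)=\sum_{p\in\mathcal{SI}^i_0}\bigl([S_p^+(D_p)]-[S_p^-(D_p)]\bigr)\in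 ch_e$$ (zero if $D$ has fewer than $i$ core circles), and let $\mu_i: ch_e\to ch_e$ be the linear map whose value on the class of a diagram is the sum $\mu_i(D)$ for a representative $D$ of the class in general position. **Proposition.** For every $i\ge 1$, $$\tau_i\circ\mu_i=-\mu_i$$ as linear maps $ch_e\to ch_e$. Moreover, for every diagram $D$ in general position the sum that defines $\mu_i$ satisfies $\tau_i(\mu_i(D))=-\mu_i(D)$ in $ch_e$. -/

import Mathlib

open scoped Manifold ContDiff

noncomputable section

namespace ChordDiagrams

/-! ## Labelled chord diagrams with external chords on a space -/

/-- The oriented circle `ℝ / ℤ`. -/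
abbrev S1 : Type := AddCircle (1 : ℝ)

/-- A geometrical chord diagram with external chords only and with `n` labelled core circles: the
core circle with label `j` is a copy of `ℝ / ℤ` mapped to `F` by `curve j`; an (unoriented) chord is
the unordered pair of its endpoints, a point on the core circle `j` being a pair `(j, t)`. As a chord
is mapped to a single point of `F`, the map on it is determined by the map on its endpoints.
The label `j : Fin n` stands for the digit `j + 1` of `{1, ..., n}`. -/
structure Diagram (F : Type*) [TopologicalSpace F] (n : ℕ) where
  curve : Fin n → C(S1, F)
  chords : Set (Sym2 (Fin n × S1))
  finite_chords : chords.Finite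
  disjoint : ∀ c ∈ chords, ∀ d ∈ chords, ∀ e, e ∈ c → e ∈ d → c = d
  external : ∀ e e', s(e, e') ∈ chords → e.1 ≠ e'.1
  glued : ∀ e e', s(e, e') ∈ chords → curve e.1 e.2 = curve e'.1 e'.2

section Basic

variable {F : Type*} [TopologicalSpace F] {n : ℕ}

/-- The core circle `j`, as a map of period one on the real line. -/
def Diagram.lift (D : Diagram F n) (j : Fin n) (x : ℝ) : F := D.curve j (x : S1)

/-- `e` is an endpoint of a chord of `D`. -/
def Diagram.IsEndpoint (D : Diagram F n) (e : Fin n × S1) : Prop := ∃ c ∈ D.chords, e ∈ c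

/-- Orientation-preserving homeomorphisms of the circle. -/
def OrientationPreserving (φ : S1 ≃ₜ S1) : Prop :=
  ∃ g : ℝ → ℝ, Continuous g ∧ StrictMono g ∧ ∀ x : ℝ, φ (x : S1) = ((g x : ℝ) : S1)

/-- Homotopy of geometrical chord diagrams: an orientation-preserving identification of the labelled
core circles that carries chords to chords, and a homotopy of the maps that at each time maps each
chord to a point. -/
def Homotopic (D D' : Diagram F n) : Prop :=
  ∃ φ : Fin n → (S1 ≃ₜ S1), (∀ j, OrientationPreserving (φ j)) ∧
    D'.chords = Sym2.map (fun e => (e.1, φ e.1 e.2)) '' D.chords ∧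
    ∃ H : Fin n → C(unitInterval × S1, F),
      (∀ j t, H j (0, t) = D.curve j t) ∧
      (∀ j t, H j (1, t) = D'.curve j (φ j t)) ∧
      ∀ e e', s(e, e') ∈ D.chords → ∀ u, H e.1 (u, e.2) = H e'.1 (u, e'.2)

/-! ### Sliding chords -/

/-- `(j, u)` and `(j, v)` bound an arc of the core circle `j` that contains no further chord endpoint
and that is mapped to a single point. -/
def Diagram.Adjacent (D : Diagram F n) (j : Fin n) (u v : S1) : Prop :=
  ∃ x y : ℝ, x < y ∧ y < x + 1 ∧ s(u, v) = s((x : S1), (y : S1)) ∧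
    (∀ r ∈ Set.Icc x y, D.lift j r = D.lift j x) ∧
    ∀ r ∈ Set.Ioo x y, ¬ D.IsEndpoint (j, (r : S1))

/-- Sliding a chord past another one: two chords have adjacent endpoints on a core circle, and the
order of these two endpoints is exchanged. -/
def SlidePast (D D' : Diagram F n) : Prop :=
  ∃ (R : Set (Sym2 (Fin n × S1))) (j : Fin n) (u v : S1) (a b : Fin n × S1),
    D'.curve = D.curve ∧ D.Adjacent j u v ∧
    D.chords = {s(a, (j, u)), s(b, (j, v))} ∪ R ∧
    D'.chords = {s(a, (j, v)), s(b, (j, u))} ∪ R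

/-- Sliding a chord from one core circle to another: a chord from `a` to the core circle `j` is
adjacent to an endpoint of a chord that joins the core circles `j` and `l`, and it slides across the
latter chord to an adjacent point of the core circle `l`. (As `D'` has external chords only,
`a`, `j` and `l` are three distinct core circles.) -/
def SlideAcross (D D' : Diagram F n) : Prop :=
  ∃ (R : Set (Sym2 (Fin n × S1))) (j l : Fin n) (u v z z' : S1) (a : Fin n × S1),
    D'.curve = D.curve ∧ D.Adjacent j u v ∧ D.Adjacent l z z' ∧
    D.chords = {s(a, (j, u)), s((j, v), (l, z))} ∪ R ∧
    D'.chords = {s(a, (l, z')), s((j, v), (l, z))} ∪ R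

/-! ### Relabelling the core circles -/

/-- Labels the core circle formerly labelled `j` by `σ j`. -/
def Diagram.relabel (σ : Equiv.Perm (Fin n)) (D : Diagram F n) : Diagram F n where
  curve j := D.curve (σ.symm j)
  chords := Sym2.map (fun e => (σ e.1, e.2)) '' D.chords
  finite_chords := D.finite_chords.image _
  disjoint := by
    rintro _ ⟨c, hc, rfl⟩ _ ⟨d, hd, rfl⟩ e he he'
    rw [Sym2.mem_map] at he he'
    obtain ⟨p, hp, rfl⟩ := he
    obtain ⟨q, hq, h⟩ := he'
    have hpq : q = p := by
      have h1 := congrArg Prod.fst h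
      have h2 := congrArg Prod.snd h
      exact Prod.ext (σ.injective h1) h2
    subst hpq
    rw [D.disjoint c hc d hd q hp hq]
  external := by
    rintro e e' ⟨c, hc, h⟩
    induction c with | _ p q =>
    have hne := D.external p q hc
    simp only [Sym2.map_mk, Sym2.eq_iff] at h
    rcases h with ⟨rfl, rfl⟩ | ⟨rfl, rfl⟩
    · exact fun h => hne (σ.injective h)
    · exact fun h => hne (σ.injective h).symm
  glued := by
    rintro e e' ⟨c, hc, h⟩
    induction c with | _ p q =>
    have hg := D.glued p q hc
    simp only [Sym2.map_mk, Sym2.eq_iff] at h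
    rcases h with ⟨rfl, rfl⟩ | ⟨rfl, rfl⟩
    · simpa using hg
    · simpa using hg.symm

theorem Homotopic.relabel (σ : Equiv.Perm (Fin n)) {D D' : Diagram F n} (h : Homotopic D D') :
    Homotopic (D.relabel σ) (D'.relabel σ) := by
  obtain ⟨φ, hφ, hc, H, h0, h1, hg⟩ := h
  refine ⟨fun j => φ (σ.symm j), fun j => hφ _, ?_, fun j => H (σ.symm j), fun j t => h0 _ t,
    fun j t => h1 _ t, ?_⟩
  · simp only [Diagram.relabel, hc, Set.image_image, Sym2.map_map]
    congr 1
    funext c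
    congr 1
    funext e
    simp
  · rintro e e' ⟨c, hcc, h⟩ u
    induction c with | _ p q =>
    have hg' := hg p q hcc u
    simp only [Sym2.map_mk, Sym2.eq_iff] at h
    rcases h with ⟨rfl, rfl⟩ | ⟨rfl, rfl⟩
    · simpa using hg'
    · simpa using hg'.symm

theorem Diagram.Adjacent.relabel (σ : Equiv.Perm (Fin n)) {D : Diagram F n} {j : Fin n} {u v : S1}
    (h : D.Adjacent j u v) : (D.relabel σ).Adjacent (σ j) u v := by
  obtain ⟨x, y, hxy, hyx, hs, hconst, hend⟩ := h
  refine ⟨x, y, hxy, hyx, hs, ?_, ?_⟩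
  · simpa [Diagram.lift, Diagram.relabel] using hconst
  · rintro r hr ⟨_, ⟨c, hc, rfl⟩, he⟩
    rw [Sym2.mem_map] at he
    obtain ⟨⟨p1, p2⟩, hp, hpe⟩ := he
    simp only [Prod.mk.injEq, EmbeddingLike.apply_eq_iff_eq] at hpe
    obtain ⟨rfl, rfl⟩ := hpe
    exact hend r hr ⟨c, hc, hp⟩

theorem SlidePast.relabel (σ : Equiv.Perm (Fin n)) {D D' : Diagram F n} (h : SlidePast D D') :
    SlidePast (D.relabel σ) (D'.relabel σ) := by
  obtain ⟨R, j, u, v, a, b, hcurve, hadj, h1, h2⟩ := h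
  refine ⟨Sym2.map (fun e => (σ e.1, e.2)) '' R, σ j, u, v, (σ a.1, a.2), (σ b.1, b.2), ?_,
    hadj.relabel σ, ?_, ?_⟩
  · simp [Diagram.relabel, hcurve]
  · simp [Diagram.relabel, h1, Set.image_union, Set.image_insert_eq]
  · simp [Diagram.relabel, h2, Set.image_union, Set.image_insert_eq]

theorem SlideAcross.relabel (σ : Equiv.Perm (Fin n)) {D D' : Diagram F n} (h : SlideAcross D D') :
    SlideAcross (D.relabel σ) (D'.relabel σ) := by
  obtain ⟨R, j, l, u, v, z, z', a, hcurve, hadj, hadj', h1, h2⟩ := h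
  refine ⟨Sym2.map (fun e => (σ e.1, e.2)) '' R, σ j, σ l, u, v, z, z', (σ a.1, a.2), ?_,
    hadj.relabel σ, hadj'.relabel σ, ?_, ?_⟩
  · simp [Diagram.relabel, hcurve]
  · simp [Diagram.relabel, h1, Set.image_union, Set.image_insert_eq]
  · simp [Diagram.relabel, h2, Set.image_union, Set.image_insert_eq]

end Basic

/-! ## The module `ch_e` and the maps `τ_i` -/

section Module

variable (F : Type*) [TopologicalSpace F]

/-- Chord diagrams on `F` with labelled core circles and external chords only: homotopy classes of
geometrical chord diagrams, with any number of core circles. -/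
def ChordDiagram : Type _ := Σ n : ℕ, Quot (Homotopic (F := F) (n := n))

variable {F}

/-- The homotopy class of a geometrical chord diagram. -/
def Diagram.cls {n : ℕ} (D : Diagram F n) : ChordDiagram F := ⟨n, Quot.mk _ D⟩

/-- Two chord diagrams that have representatives which differ by a slide. -/
def SlideRel (c c' : ChordDiagram F) : Prop :=
  ∃ (n : ℕ) (D D' : Diagram F n),
    (SlidePast D D' ∨ SlideAcross D D') ∧ c = D.cls ∧ c' = D'.cls

variable (F)

/-- The free `ℤ`-module on the chord diagrams with external chords only. -/
abbrev FreeModule : Type _ := ChordDiagram F →₀ ℤ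

/-- The submodule generated by the slide relations. -/
def SlideSubmodule : Submodule ℤ (FreeModule F) :=
  Submodule.span ℤ
    {m | ∃ c c' : ChordDiagram F, SlideRel c c' ∧ m = Finsupp.single c 1 - Finsupp.single c' 1}

/-- The module `ch_e`. -/
abbrev ChE : Type _ := FreeModule F ⧸ SlideSubmodule F

variable {F}

/-- The generator `[D]` of `ch_e`. -/
def Diagram.toChE {n : ℕ} (D : Diagram F n) : ChE F :=
  (SlideSubmodule F).mkQ (Finsupp.single D.cls 1)

/-- The transposition of the labels `i` and `i + 1` (if there are core circles with both labels). -/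
def swapLabels (n i : ℕ) : Equiv.Perm (Fin n) :=
  if h : i + 1 < n then Equiv.swap ⟨i, Nat.lt_of_succ_lt h⟩ ⟨i + 1, h⟩ else 1

/-- The effect on a chord diagram of swapping the labels `i` and `i + 1`. -/
def swapClass (i : ℕ) (c : ChordDiagram F) : ChordDiagram F :=
  ⟨c.1, Quot.map (Diagram.relabel (swapLabels c.1 i)) (fun _ _ h => h.relabel _) c.2⟩

theorem SlideRel.swapClass (i : ℕ) {c c' : ChordDiagram F} (h : SlideRel c c') :
    SlideRel (swapClass i c) (swapClass i c') := by
  obtain ⟨n, D, D', hs, rfl, rfl⟩ := h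
  exact ⟨n, D.relabel (swapLabels n i), D'.relabel (swapLabels n i),
    hs.imp (fun h => h.relabel _) (fun h => h.relabel _), rfl, rfl⟩

theorem slideSubmodule_le_comap_swapClass (i : ℕ) :
    SlideSubmodule F ≤ (SlideSubmodule F).comap (Finsupp.lmapDomain ℤ ℤ (swapClass i)) := by
  refine Submodule.span_le.2 ?_
  rintro _ ⟨c, c', h, rfl⟩
  refine Submodule.subset_span ⟨swapClass i c, swapClass i c', h.swapClass i, ?_⟩
  rw [map_sub, Finsupp.lmapDomain_apply, Finsupp.lmapDomain_apply, Finsupp.mapDomain_single,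
    Finsupp.mapDomain_single]

/-- The map `τ_i` on `ch_e` that swaps the labels `i` and `i + 1`. -/
def tau (i : ℕ) : ChE F →ₗ[ℤ] ChE F :=
  Submodule.mapQ (SlideSubmodule F) (SlideSubmodule F) (Finsupp.lmapDomain ℤ ℤ (swapClass i))
    (slideSubmodule_le_comap_swapClass i)

end Module

/-! ## Splitting a core circle at a self-intersection point -/

section Split

variable {F : Type*} [TopologicalSpace F] {n : ℕ}

/-- For `f x = f y`, the loop obtained by traversing `f` from `x` to `y`, parametrized by `ℝ / ℤ`
with the point `0` at the common image of `x` and `y`. -/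
def arcLoop (f : C(S1, F)) (x y : ℝ) (h : f (x : S1) = f (y : S1)) : C(S1, F) where
  toFun := AddCircle.liftIco 1 0 fun r : ℝ => f ((x + r * (y - x) : ℝ) : S1)
  continuous_toFun := by
    refine AddCircle.liftIco_zero_continuous (by simpa using h) (Continuous.continuousOn ?_)
    exact f.continuous.comp ((AddCircle.continuous_mk' 1).comp (by fun_prop))

/-- A self-intersection point of the core circle `i`, away from chord endpoints: an unordered pair of
distinct points of `ℝ / ℤ` with the same image, written through its representatives
`0 ≤ x < y < 1`. -/
structure SelfInt (D : Diagram F n) (i : Fin n) where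
  x : ℝ
  y : ℝ
  nonneg : 0 ≤ x
  lt : x < y
  lt_one : y < 1
  eq : D.curve i (x : S1) = D.curve i (y : S1)
  x_free : ¬ D.IsEndpoint (i, (x : S1))
  y_free : ¬ D.IsEndpoint (i, (y : S1))

namespace SelfInt

variable {D : Diagram F n} {i : Fin n}

/-- The loop `a([x, y])`. -/
def loopA (p : SelfInt D i) : C(S1, F) := arcLoop (D.curve i) p.x p.y p.eq

/-- The loop `a([y, x])`, along the arc from `y` to `x` in the direction of the orientation. -/
def loopB (p : SelfInt D i) : C(S1, F) :=
  arcLoop (D.curve i) p.y (p.x + 1)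
    (by rw [← p.eq, AddCircle.coe_add, AddCircle.coe_period, add_zero])

/-- Neither of the two loops at the self-intersection point is homotopically trivial. -/
def Essential (p : SelfInt D i) : Prop := ¬ p.loopA.Nullhomotopic ∧ ¬ p.loopB.Nullhomotopic

/-- The new label of the core circle `a([x, y])`: it is `i` if `b` is true, and `i + 1` otherwise. -/
def labelA (i : Fin n) (b : Bool) : Fin (n + 1) := if b then i.castSucc else i.succ

/-- The new label of the core circle `a([y, x])`. -/
def labelB (i : Fin n) (b : Bool) : Fin (n + 1) := if b then i.succ else i.castSucc

/-- Where a point of a core circle of `D` lies after the splitting. On the circles other than `i`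
only the label changes: it increases by one if it is greater than `i`. A point of the circle `i` goes
to the point of `a([x, y])` or `a([y, x])` that it became. -/
def move (p : SelfInt D i) (b : Bool) (e : Fin n × S1) : Fin (n + 1) × S1 :=
  if e.1 = i then
    let r : ℝ := (AddCircle.equivIco 1 p.x e.2 : ℝ)
    if r < p.y then (labelA i b, (((r - p.x) / (p.y - p.x) : ℝ) : S1))
    else (labelB i b, (((r - p.y) / (p.x + 1 - p.y) : ℝ) : S1))
  else (i.castSucc.succAbove e.1, e.2)

/-- The core circles after the splitting. -/
def splitCurve (p : SelfInt D i) (b : Bool) (k : Fin (n + 1)) : C(S1, F) :=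
  if k = labelA i b then p.loopA else if k = labelB i b then p.loopB
  else D.curve (i.predAbove k)

theorem labelA_ne_labelB (i : Fin n) (b : Bool) : labelA i b ≠ labelB i b := by
  cases b <;> simp [labelA, labelB, Fin.ext_iff]

theorem succAbove_ne (i j : Fin n) (b : Bool) (h : j ≠ i) :
    i.castSucc.succAbove j ≠ labelA i b ∧ i.castSucc.succAbove j ≠ labelB i b := by
  have h1 : i.castSucc.succAbove j ≠ i.castSucc := Fin.succAbove_ne _ _
  have h2 : i.castSucc.succAbove j ≠ i.succ := by
    rw [← Fin.succAbove_castSucc_self i]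
    exact fun h' => h (Fin.succAbove_right_injective h')
  cases b <;> simp [labelA, labelB, h1, h2]

theorem move_of_ne (p : SelfInt D i) (b : Bool) (e : Fin n × S1) (h : e.1 ≠ i) :
    p.move b e = (i.castSucc.succAbove e.1, e.2) := if_neg h

/-- The points of the circle `i` are the images of a unique `r` in `[x, y)` or `[y, x + 1)`. -/
theorem move_eq (p : SelfInt D i) (b : Bool) (t : S1) :
    (∃ r : ℝ, p.x ≤ r ∧ r < p.y ∧ t = (r : S1) ∧
      p.move b (i, t) = (labelA i b, (((r - p.x) / (p.y - p.x) : ℝ) : S1))) ∨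
    (∃ r : ℝ, p.y ≤ r ∧ r < p.x + 1 ∧ t = (r : S1) ∧
      p.move b (i, t) = (labelB i b, (((r - p.y) / (p.x + 1 - p.y) : ℝ) : S1))) := by
  have hm := (AddCircle.equivIco 1 p.x t).2
  have ht : t = ((AddCircle.equivIco 1 p.x t : ℝ) : S1) := AddCircle.coe_equivIco.symm
  by_cases h : (AddCircle.equivIco 1 p.x t : ℝ) < p.y
  · exact Or.inl ⟨_, hm.1, h, ht, by simp [move, h]⟩
  · exact Or.inr ⟨_, not_lt.1 h, hm.2, ht, by simp [move, h]⟩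

theorem move_fst (p : SelfInt D i) (b : Bool) (e : Fin n × S1) :
    ((p.move b e).1 = labelA i b ∨ (p.move b e).1 = labelB i b) ↔ e.1 = i := by
  constructor
  · intro h
    by_contra hne
    rw [move_of_ne p b e hne] at h
    have := succAbove_ne i e.1 b hne
    tauto
  · obtain ⟨j, t⟩ := e
    rintro rfl
    rcases p.move_eq b t with ⟨r, -, -, -, h⟩ | ⟨r, -, -, -, h⟩ <;> simp [h]

theorem arcLoop_coe (f : C(S1, F)) (x y r : ℝ) (h : f (x : S1) = f (y : S1)) (hx : x ≤ r)
    (hy : r < y) : arcLoop f x y h (((r - x) / (y - x) : ℝ) : S1) = f (r : S1) := by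
  have hpos : 0 < y - x := by linarith
  have hmem : (r - x) / (y - x) ∈ Set.Ico (0 : ℝ) (0 + 1) := by
    refine ⟨div_nonneg (by linarith) hpos.le, ?_⟩
    rw [zero_add, div_lt_one hpos]
    linarith
  change AddCircle.liftIco (1 : ℝ) 0 (fun r : ℝ => f ((x + r * (y - x) : ℝ) : S1)) _ = _
  rw [AddCircle.liftIco_coe_apply hmem, div_mul_cancel₀ _ hpos.ne']
  congr 2
  ring

theorem splitCurve_move (p : SelfInt D i) (b : Bool) (e : Fin n × S1) :
    p.splitCurve b (p.move b e).1 (p.move b e).2 = D.curve e.1 e.2 := by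
  obtain ⟨j, t⟩ := e
  by_cases hj : j = i
  · subst hj
    rcases p.move_eq b t with ⟨r, h1, h2, rfl, h⟩ | ⟨r, h1, h2, rfl, h⟩
    · rw [h]
      simp only [splitCurve, if_true]
      exact arcLoop_coe _ _ _ _ _ h1 h2
    · rw [h]
      simp only [splitCurve, (labelA_ne_labelB _ b).symm, if_true, if_false]
      exact arcLoop_coe _ _ _ _ _ h1 h2
  · have hne := succAbove_ne i j b hj
    rw [move_of_ne p b (j, t) hj]
    simp only [splitCurve, hne.1, hne.2, if_false]
    congr 2
    rcases lt_or_gt_of_ne hj with h | h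
    · rw [Fin.succAbove_of_castSucc_lt _ _ (by simpa using h)]
      rw [Fin.predAbove_of_le_castSucc _ _ (by simpa using h.le)]
      simp
    · rw [Fin.succAbove_of_lt_succ _ _ (by
        rw [Fin.lt_def] at h ⊢; simp; omega)]
      rw [Fin.predAbove_of_castSucc_lt _ _ (by
        rw [Fin.lt_def] at h ⊢; simp; omega)]
      simp

theorem div_eq_of_coe_eq {x y r r' : ℝ} (hr : x ≤ r) (hr' : x ≤ r') (hy : r < y) (hy' : r' < y)
    (h : (((r - x) / (y - x) : ℝ) : S1) = (((r' - x) / (y - x) : ℝ) : S1)) : r = r' := by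
  have hpos : 0 < y - x := by linarith
  have hmem : ∀ s, x ≤ s → s < y → (s - x) / (y - x) ∈ Set.Ico (0 : ℝ) (0 + 1) := by
    intro s h1 h2
    refine ⟨div_nonneg (by linarith) hpos.le, ?_⟩
    rw [zero_add, div_lt_one hpos]
    linarith
  have := (AddCircle.coe_eq_coe_iff_of_mem_Ico (hmem r hr hy) (hmem r' hr' hy')).1 h
  rw [div_left_inj' hpos.ne'] at this
  linarith

theorem move_injective (p : SelfInt D i) (b : Bool) : Function.Injective (p.move b) := by
  rintro ⟨j, t⟩ ⟨j', t'⟩ h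
  have hi : j = i ↔ j' = i := by
    have h1 := p.move_fst b (j, t)
    have h2 := p.move_fst b (j', t')
    rw [h] at h1
    exact h1.symm.trans h2
  by_cases hj : j = i
  · have hj' := hi.1 hj
    subst hj'
    subst hj
    rcases p.move_eq b t with ⟨r, h1, h2, rfl, hr⟩ | ⟨r, h1, h2, rfl, hr⟩ <;>
      rcases p.move_eq b t' with ⟨r', h1', h2', rfl, hr'⟩ | ⟨r', h1', h2', rfl, hr'⟩ <;>
      rw [hr, hr', Prod.mk.injEq] at h
    · rw [div_eq_of_coe_eq h1 h1' h2 h2' h.2]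
    · exact absurd h.1 (labelA_ne_labelB _ b)
    · exact absurd h.1 (labelA_ne_labelB _ b).symm
    · rw [div_eq_of_coe_eq h1 h1' h2 h2' h.2]
  · have hj' : j' ≠ i := fun h' => hj (hi.2 h')
    rw [move_of_ne p b (j, t) hj, move_of_ne p b (j', t') hj', Prod.mk.injEq] at h
    exact Prod.ext (Fin.succAbove_right_injective h.1) h.2

theorem move_x (p : SelfInt D i) (b : Bool) : p.move b (i, (p.x : S1)) = (labelA i b, 0) := by
  have hmem : p.x ∈ Set.Ico p.x (p.x + 1) := ⟨le_rfl, by linarith⟩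
  simp [move, AddCircle.equivIco_coe_of_mem hmem, p.lt]

theorem move_y (p : SelfInt D i) (b : Bool) : p.move b (i, (p.y : S1)) = (labelB i b, 0) := by
  have hmem : p.y ∈ Set.Ico p.x (p.x + 1) := ⟨p.lt.le, by linarith [p.nonneg, p.lt_one]⟩
  simp [move, AddCircle.equivIco_coe_of_mem hmem]

/-- A chord endpoint of `D` does not move to an endpoint of the new chord. -/
theorem move_ne (p : SelfInt D i) (b : Bool) {e : Fin n × S1} (he : D.IsEndpoint e) :
    p.move b e ≠ (labelA i b, 0) ∧ p.move b e ≠ (labelB i b, 0) := by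
  refine ⟨fun h => p.x_free ?_, fun h => p.y_free ?_⟩
  · rw [← p.move_x b] at h
    rwa [← p.move_injective b h]
  · rw [← p.move_y b] at h
    rwa [← p.move_injective b h]

/-- Adds a chord between the two points `x` and `y` and splits the core circle `i` there into
`a([x, y])` and `a([y, x])`, with labels `i` and `i + 1` in the order given by `b`; the new chord
connects the points of the two new core circles at the self-intersection point. -/
def split (p : SelfInt D i) (b : Bool) : Diagram F (n + 1) where
  curve := p.splitCurve b
  chords := insert s((labelA i b, 0), (labelB i b, 0)) (Sym2.map (p.move b) '' D.chords)
  finite_chords := (D.finite_chords.image _).insert _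
  disjoint := by
    rintro c hc d hd e hec hed
    rcases hc with rfl | ⟨c, hc, rfl⟩ <;> rcases hd with rfl | ⟨d, hd, rfl⟩
    · rfl
    · obtain ⟨q, hq, rfl⟩ := Sym2.mem_map.1 hed
      have := p.move_ne b ⟨d, hd, hq⟩
      rw [Sym2.mem_iff] at hec
      tauto
    · obtain ⟨q, hq, rfl⟩ := Sym2.mem_map.1 hec
      have := p.move_ne b ⟨c, hc, hq⟩
      rw [Sym2.mem_iff] at hed
      tauto
    · obtain ⟨q, hq, rfl⟩ := Sym2.mem_map.1 hec
      obtain ⟨q', hq', h⟩ := Sym2.mem_map.1 hed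
      have := p.move_injective b h
      subst this
      rw [D.disjoint c hc d hd q' hq hq']
  external := by
    have key : ∀ q q' : Fin n × S1, q.1 ≠ q'.1 → (p.move b q).1 ≠ (p.move b q').1 := by
      intro q q' hne h
      have h1 := p.move_fst b q
      have h2 := p.move_fst b q'
      rw [h] at h1
      have h3 : q.1 = i ↔ q'.1 = i := h1.symm.trans h2
      by_cases hq : q.1 = i
      · exact hne (hq.trans (h3.1 hq).symm)
      · have hq' : q'.1 ≠ i := fun h' => hq (h3.2 h')
        rw [move_of_ne p b q hq, move_of_ne p b q' hq'] at h
        exact hne (Fin.succAbove_right_injective h)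
    rintro e e' (h | ⟨c, hc, h⟩)
    · rcases Sym2.eq_iff.1 h with ⟨rfl, rfl⟩ | ⟨rfl, rfl⟩
      · exact labelA_ne_labelB i b
      · exact (labelA_ne_labelB i b).symm
    · induction c with | _ q q' =>
      have hne := D.external q q' hc
      rcases Sym2.eq_iff.1 h with ⟨rfl, rfl⟩ | ⟨rfl, rfl⟩
      · exact key _ _ hne
      · exact key _ _ hne.symm
  glued := by
    have hx := p.splitCurve_move b (i, (p.x : S1))
    have hy := p.splitCurve_move b (i, (p.y : S1))
    rw [move_x] at hx
    rw [move_y] at hy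
    have hxy := (hx.trans p.eq).trans hy.symm
    rintro e e' (h | ⟨c, hc, h⟩)
    · rcases Sym2.eq_iff.1 h with ⟨rfl, rfl⟩ | ⟨rfl, rfl⟩
      · exact hxy
      · exact hxy.symm
    · induction c with | _ q q' =>
      have hg := D.glued q q' hc
      rcases Sym2.eq_iff.1 h with ⟨rfl, rfl⟩ | ⟨rfl, rfl⟩
      · rw [splitCurve_move, splitCurve_move]
        exact hg
      · rw [splitCurve_move, splitCurve_move]
        exact hg.symm

end SelfInt

end Split

/-! ## Oriented surfaces, general position, and the maps `μ_i` -/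

section Mu

variable {H : Type*} [TopologicalSpace H]
  (I : ModelWithCorners ℝ (EuclideanSpace ℝ (Fin 2)) H)
  (F : Type*) [TopologicalSpace F] [ChartedSpace H F] [IsManifold I ∞ F]

/-- An orientation of a surface: an orientation of each tangent plane that is constant near each point
in a local trivialization of the tangent bundle. -/
structure SurfaceOrientation where
  at_ : ∀ p : F, Orientation ℝ (TangentSpace I p) (Fin 2)
  locally_constant : ∀ p : F, ∀ᶠ q in nhds p,
    ∀ hq : q ∈ (trivializationAt (EuclideanSpace ℝ (Fin 2)) (TangentSpace I) p).baseSet,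
    ∀ hp : p ∈ (trivializationAt (EuclideanSpace ℝ (Fin 2)) (TangentSpace I) p).baseSet,
      Orientation.map (Fin 2)
          ((trivializationAt (EuclideanSpace ℝ (Fin 2)) (TangentSpace I) p).continuousLinearEquivAt
            ℝ q hq).toLinearEquiv (at_ q) =
        Orientation.map (Fin 2)
          ((trivializationAt (EuclideanSpace ℝ (Fin 2)) (TangentSpace I) p).continuousLinearEquivAt
            ℝ p hp).toLinearEquiv (at_ p)

variable {I F} {n : ℕ}

/-- `(v, w)` is a basis of the tangent plane at `p` that gives the chosen orientation. -/
def SurfaceOrientation.IsPositive (o : SurfaceOrientation I F) (p : F) (v w : TangentSpace I p) :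
    Prop :=
  ∃ b : Module.Basis (Fin 2) ℝ (TangentSpace I p), b 0 = v ∧ b 1 = w ∧ b.orientation = o.at_ p

variable (I)

/-- The velocity of the core circle `j` at `x`. -/
def Diagram.velocity (D : Diagram F n) (j : Fin n) (x : ℝ) : TangentSpace I (D.lift j x) :=
  mfderiv 𝓘(ℝ, ℝ) I (D.lift j) x (1 : ℝ)

/-- General position: the core circles are smooth immersed curves whose intersections and
self-intersections are transverse, each core circle has finitely many self-intersection points, and
none of these is at a chord endpoint. -/
structure Diagram.GeneralPosition (D : Diagram F n) : Prop where
  smooth : ∀ j, ContMDiff 𝓘(ℝ, ℝ) I ∞ (D.lift j)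
  immersed : ∀ j x, D.velocity I j x ≠ 0
  transverse : ∀ j k, ∀ x ∈ Set.Ico (0 : ℝ) 1, ∀ y ∈ Set.Ico (0 : ℝ) 1, (j, x) ≠ (k, y) →
    ∀ h : D.lift j x = D.lift k y,
      LinearIndependent ℝ
        (![D.velocity I j x, h ▸ D.velocity I k y] : Fin 2 → TangentSpace I (D.lift j x))
  finite : ∀ j, Finite (SelfInt D j)
  endpoint : ∀ e, D.IsEndpoint e → ∀ t, D.curve e.1 t = D.curve e.1 e.2 → t = e.2

variable {I}

section
variable (o : SurfaceOrientation I F) {D : Diagram F n} {i : Fin n}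

/-- The pair of velocities at `x` and `y` gives the orientation of `F`, i.e. `a^1_p` is
`a([x, y])` and `a^2_p` is `a([y, x])`; otherwise it is the other way round. -/
def SelfInt.Positive (p : SelfInt D i) : Prop :=
  o.IsPositive (D.lift i p.x) (D.velocity I i p.x)
    ((show D.lift i p.y = D.lift i p.x from p.eq.symm) ▸ D.velocity I i p.y)

open Classical in
/-- `S_p^+(D_p)`: the new core circle `i` is `a^1_p` and the new core circle `i + 1` is `a^2_p`. -/
def SelfInt.splitPlus (p : SelfInt D i) : Diagram F (n + 1) := p.split (decide (p.Positive o))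

open Classical in
/-- `S_p^-(D_p)`: the new core circle `i` is `a^2_p` and the new core circle `i + 1` is `a^1_p`. -/
def SelfInt.splitMinus (p : SelfInt D i) : Diagram F (n + 1) := p.split (!decide (p.Positive o))

end

/-- The sum of `[S_p^+(D_p)] - [S_p^-(D_p)]` over the self-intersection points `p` of the core circle
`i` at which neither loop is homotopically trivial (an empty sum if there is no core circle `i`). -/
def muSum (o : SurfaceOrientation I F) (i : ℕ) (D : Diagram F n) : ChE F :=
  if h : i < n then
    ∑ᶠ p : {p : SelfInt D ⟨i, h⟩ // p.Essential},
      ((p.1.splitPlus o).toChE - (p.1.splitMinus o).toChE)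
  else 0

/-- Chord diagrams up to the slide relations; `ch_e` is free on this set. -/
def SlideClass (F : Type*) [TopologicalSpace F] : Type _ := Quot (SlideRel (F := F))

/-- The class of a chord diagram up to the slide relations. -/
def ChordDiagram.slideClass {F : Type*} [TopologicalSpace F] (c : ChordDiagram F) : SlideClass F :=
  Quot.mk _ c

open Classical in
/-- The value of `μ_i` on a class `q`: the sum `muSum o i D` for a representative `D` of `q` in general
position. -/
def muClass (o : SurfaceOrientation I F) (i : ℕ) (q : SlideClass F) : ChE F :=
  if h : ∃ D : (Σ n, Diagram F n), D.2.GeneralPosition I ∧ D.2.cls.slideClass = q then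
    muSum o i h.choose.2
  else 0

/-- The map `μ_i : ch_e → ch_e`, the linear extension of `muClass`. It sends the generator `[D]` to the
sum `muSum o i D` computed from a representative `D` in general position. -/
def mu (o : SurfaceOrientation I F) (i : ℕ) : ChE F →ₗ[ℤ] ChE F :=
  (SlideSubmodule F).liftQ
    (Finsupp.linearCombination ℤ fun c : ChordDiagram F => muClass o i c.slideClass)
    (by
      refine Submodule.span_le.2 ?_
      rintro _ ⟨c, c', h, rfl⟩
      have hq : c.slideClass = c'.slideClass := Quot.sound h
      change Finsupp.linearCombination ℤ _ _ = 0
      rw [map_sub, Finsupp.linearCombination_single, Finsupp.linearCombination_single, hq, sub_self])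

end Mu

end ChordDiagrams

end

/-!
Splitting the `i`-th core circle at a self-intersection point `p` gives two core circles, labelled
`i` and `i + 1`, and `S_p^+(D_p)`, `S_p^-(D_p)` differ only in which of the two gets which label.
Hence swapping the labels `i` and `i + 1` exchanges the geometrical diagrams `S_p^+(D_p)` and
`S_p^-(D_p)` themselves (`SelfInt.relabel_split`), before homotopies and slides are divided out.
So `τ_i` changes the sign of each summand `[S_p^+(D_p)] - [S_p^-(D_p)]`, and of the sum, which is
finite in general position (`tau_muSum`).

The value of `μ_i` on a generator of `ch_e` is such a sum for some diagram in general position, so the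
identity of linear maps follows by comparing the two sides on generators (`tau_muClass`). As the sign
changes for every diagram in general position, it is irrelevant which representative is chosen.
-/

namespace ChordDiagrams

section Relabel

variable {F : Type*} [TopologicalSpace F] {n : ℕ}

@[ext]
theorem Diagram.ext {D D' : Diagram F n} (hcurve : D.curve = D'.curve)
    (hchords : D.chords = D'.chords) : D = D' := by
  cases D
  cases D'
  subst hcurve
  subst hchords
  rfl

theorem tau_toChE (i : ℕ) (D : Diagram F n) :
    tau i D.toChE = (D.relabel (swapLabels n i)).toChE := by
  rw [Diagram.toChE, Submodule.mkQ_apply, tau, Submodule.mapQ_apply, Finsupp.lmapDomain_apply,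
    Finsupp.mapDomain_single]
  rfl

theorem swapLabels_succ (i : Fin n) :
    swapLabels (n + 1) i = Equiv.swap i.castSucc i.succ := by
  rw [swapLabels, dif_pos (Nat.succ_lt_succ i.isLt)]
  rfl

namespace SelfInt

variable {D : Diagram F n} {i : Fin n}

theorem swap_labelA (i : Fin n) (b : Bool) :
    Equiv.swap i.castSucc i.succ (labelA i b) = labelA i !b := by
  cases b <;> simp [labelA]

theorem swap_labelB (i : Fin n) (b : Bool) :
    Equiv.swap i.castSucc i.succ (labelB i b) = labelB i !b := by
  cases b <;> simp [labelB]

theorem swap_move (p : SelfInt D i) (b : Bool) (e : Fin n × S1) :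
    (Equiv.swap i.castSucc i.succ (p.move b e).1, (p.move b e).2) = p.move (!b) e := by
  obtain ⟨j, t⟩ := e
  by_cases hj : j = i
  · simp only [move, if_pos hj]
    split_ifs
    · rw [swap_labelA]
    · rw [swap_labelB]
  · rw [p.move_of_ne _ _ hj, p.move_of_ne _ _ hj]
    have h := succAbove_ne i j true hj
    exact Prod.ext (Equiv.swap_apply_of_ne_of_ne h.1 h.2) rfl

theorem splitCurve_swap (p : SelfInt D i) (b : Bool) (k : Fin (n + 1)) :
    p.splitCurve b (Equiv.swap i.castSucc i.succ k) = p.splitCurve (!b) k := by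
  have hA : Equiv.swap i.castSucc i.succ k = labelA i b ↔ k = labelA i !b := by
    rw [← swap_labelA, ← Equiv.swap_apply_eq_iff]
  have hB : Equiv.swap i.castSucc i.succ k = labelB i b ↔ k = labelB i !b := by
    rw [← swap_labelB, ← Equiv.swap_apply_eq_iff]
  simp only [splitCurve, hA, hB]
  split_ifs with h1 h2
  · rfl
  · rfl
  · rw [Equiv.swap_apply_of_ne_of_ne]
    · cases b
      · exact h1
      · exact h2
    · cases b
      · exact h2
      · exact h1

/-- Swapping the labels of the two core circles obtained by a splitting gives the splitting with the
other choice of labels, as an equality of geometrical diagrams. -/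
theorem relabel_split (p : SelfInt D i) (b : Bool) :
    (p.split b).relabel (swapLabels (n + 1) i) = p.split !b := by
  rw [swapLabels_succ]
  ext1
  · funext k
    change p.splitCurve b ((Equiv.swap i.castSucc i.succ).symm k) = _
    rw [Equiv.symm_swap, splitCurve_swap]
    rfl
  · simp only [Diagram.relabel, split, Set.image_insert_eq, Set.image_image, Sym2.map_mk,
      Sym2.map_map, swap_labelA, swap_labelB]
    congr! 4
    exact funext fun e => p.swap_move b e

end SelfInt

end Relabel

section Mu

variable {H : Type*} [TopologicalSpace H] {I : ModelWithCorners ℝ (EuclideanSpace ℝ (Fin 2)) H}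
  {F : Type*} [TopologicalSpace F] [ChartedSpace H F] [IsManifold I ∞ F]
  (o : SurfaceOrientation I F) {n : ℕ}

theorem tau_splitPlus_sub_splitMinus {D : Diagram F n} {i : Fin n} (p : SelfInt D i) :
    tau i ((p.splitPlus o).toChE - (p.splitMinus o).toChE) =
      -((p.splitPlus o).toChE - (p.splitMinus o).toChE) := by
  rw [map_sub, tau_toChE, tau_toChE, SelfInt.splitPlus, SelfInt.splitMinus, p.relabel_split,
    p.relabel_split, Bool.not_not, neg_sub]

theorem tau_muSum (i : ℕ) {D : Diagram F n} (hD : D.GeneralPosition I) :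
    tau i (muSum o i D) = -muSum o i D := by
  by_cases h : i < n
  · have := hD.finite ⟨i, h⟩
    rw [muSum, dif_pos h, map_finsum _ (Set.toFinite _), ← finsum_neg_distrib]
    exact finsum_congr fun p => tau_splitPlus_sub_splitMinus o p.1
  · rw [muSum, dif_neg h, map_zero, neg_zero]

theorem tau_muClass (i : ℕ) (q : SlideClass F) : tau i (muClass o i q) = -muClass o i q := by
  unfold muClass
  split_ifs with h
  · exact tau_muSum o i h.choose_spec.1
  -- Without a representative in general position, `muClass` has the default value `0`.
  · rw [map_zero, neg_zero]

theorem mu_mkQ_single (i : ℕ) (c : ChordDiagram F) :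
    mu o i ((SlideSubmodule F).mkQ (Finsupp.single c 1)) = muClass o i c.slideClass := by
  change Finsupp.linearCombination ℤ (fun c : ChordDiagram F => muClass o i c.slideClass)
    (Finsupp.single c 1) = _
  rw [Finsupp.linearCombination_single, one_smul]

end Mu

end ChordDiagrams

theorem mainTheorem6 {H : Type*} [TopologicalSpace H]
    (I : ModelWithCorners ℝ (EuclideanSpace ℝ (Fin 2)) H)
    (F : Type*) [TopologicalSpace F] [T2Space F] [SecondCountableTopology F]
    [ChartedSpace H F] [IsManifold I ∞ F] (o : ChordDiagrams.SurfaceOrientation I F) (i : ℕ) :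
    ChordDiagrams.tau i ∘ₗ ChordDiagrams.mu o i = -ChordDiagrams.mu o i ∧
    ∀ (n : ℕ) (D : ChordDiagrams.Diagram F n), D.GeneralPosition I →
      ChordDiagrams.tau i (ChordDiagrams.muSum o i D) = -ChordDiagrams.muSum o i D := by
  refine ⟨?_, fun n D hD => ChordDiagrams.tau_muSum o i hD⟩
  refine Submodule.linearMap_qext _ (Finsupp.lhom_ext' fun c => LinearMap.ext_ring ?_)
  change ChordDiagrams.tau i (ChordDiagrams.mu o i
      ((ChordDiagrams.SlideSubmodule F).mkQ (Finsupp.single c 1))) =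
    -ChordDiagrams.mu o i ((ChordDiagrams.SlideSubmodule F).mkQ (Finsupp.single c 1))
  rw [ChordDiagrams.mu_mkQ_single, ChordDiagrams.tau_muClass]
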